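/- A component code is a binary $(n,k)$ linear block code, $k\ge 1$, given with a full-rank $k\times n$ generator matrix $G$ (the information word $u$ is encoded as $uG$); $d_{\min}$ is its minimum distance, $A_2$ its number of codewords of Hamming weight $2$, and $A_{2,u}$ the number of its weight-$2$ codewords generated by information words of weight $u$. A D-GLDPC ensemble consists of finitely many variable-node (VN) types and check-node (CN) types, each with its component code (of length $n_i$ and dimension $k_i$), and of edge fractions $\lambda_i\ge 0$ for the VN types and $\rho_i\ge 0$ for the CN types, $\sum_i\lambda_i=\sum_i\rho_i=1$. Assume that every component code has $d_{\min}\ge 2$, and that at least one VN type with $\lambda_i>0$ and at least one CN type with $\rho_i>0$ has $d_{\min}=2$. Under MAP erasure correction at the component codes, the EXIT function $I_{E,V}^{(i)}(p,q)$ of VN type $i$ is one minus the probability, averaged over the $n_i$ code bits, that a code bit is not determined by the other $n_i-1$ code bits, erased independently with probability $p$, together with the $k_i$ information bits, erased independently with probability $q$. The EXIT function $I_{E,C}^{(i)}(p)$ of CN type $i$ is defined in the same way with $q=1$. Put $I_{E,V}=\sum_i\lambda_i I_{E,V}^{(i)}$ and $I_{E,C}=\sum_i\rho_i I_{E,C}^{(i)}$.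 For a binary erasure channel (BEC) with erasure probability $q$, density evolution of the iterative decoder is $p_0=1$, $p_{l+1}=1-I_{E,C}\bigl(1-I_{E,V}(p_l,q)\bigr)$, and the asymptotic threshold is $q^*=\sup\{q\in[0,1] : p_l\to 0\}$. Let $$P(x)=\sum_{i:\,d_{\min}=2}\lambda_i\sum_{u=1}^{k_i}\frac{2A^{(i)}_{2,u}}{n_i}\,x^u,\qquad C=\sum_{i:\,d_{\min}=2}\rho_i\,\frac{2A^{(i)}_2}{n_i},$$ where the sums run over the VN types, respectively the CN types, with $d_{\min}=2$. Then $P$ is a strictly increasing bijection of $[0,\infty)$ onto itself, $C>0$, and $$q^*\le P^{-1}(1/C).$$ If moreover the ensemble is an LDPC ensemble (all VNs are repetition codes and all CNs are single parity-check codes), then, with $\lambda(x)=\sum_i\lambda_i x^{n_i-1}$ (over the VN types) and $\rho(x)=\sum_i\rho_i x^{n_i-1}$ (over the CN types), $P^{-1}(1/C)=[\lambda'(0)\rho'(1)]^{-1}$, so that the bound becomes the classical $q^*\le[\lambda'(0)\rho'(1)]^{-1}$. -/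

import Mathlib

open scoped Matrix

noncomputable section

/-- A binary `(n, k)` linear block code together with a chosen generator matrix: `G` is a `k × n`
matrix over `GF(2)` of full row rank, and `k ≥ 1`. The information word `u` is encoded as `u G`. -/
structure ComponentCode where
  /-- length -/
  n : ℕ
  /-- dimension -/
  k : ℕ
  /-- generator matrix -/
  G : Matrix (Fin k) (Fin n) (ZMod 2)
  k_pos : 0 < k
  rank_eq : G.rank = k

namespace ComponentCode

variable (c : ComponentCode)

/-- The codeword `u G` generated by the information word `u`. -/
def encode (u : Fin c.k → ZMod 2) : Fin c.n → ZMod 2 := u ᵥ* c.G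

/-- The set of codewords. -/
def codewords : Set (Fin c.n → ZMod 2) := Set.range c.encode

/-- Minimum distance, i.e. the minimum Hamming weight of a nonzero codeword (there is one, because
`k ≥ 1` and `G` has full rank). -/
def minDist : ℕ := sInf {w | ∃ x ∈ c.codewords, x ≠ 0 ∧ hammingNorm x = w}

/-- `A₂`: the number of codewords of Hamming weight `2`. -/
def A2 : ℕ := Set.ncard {x | x ∈ c.codewords ∧ hammingNorm x = 2}

/-- `A_{2,u}`: the number of codewords of Hamming weight `2` that are generated by information
words of Hamming weight `u`. -/
def A2u (u : ℕ) : ℕ :=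
  Set.ncard {x | hammingNorm x = 2 ∧ ∃ v, hammingNorm v = u ∧ c.encode v = x}

/-- Optimal (MAP) erasure correction recovers the code bit `j` from the code bits outside
`E ∪ {j}` and the information bits outside `Z` (those in `E` and `Z` being erased): any two
information words that agree with each other on everything observed give the same bit `j`. -/
def Recovers (j : Fin c.n) (E : Finset (Fin c.n)) (Z : Finset (Fin c.k)) : Prop :=
  ∀ u v : Fin c.k → ZMod 2,
    (∀ l, l ≠ j → l ∉ E → c.encode u l = c.encode v l) →
    (∀ m, m ∉ Z → u m = v m) →
    c.encode u j = c.encode v j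

open Classical in
/-- Probability that the extrinsic MAP estimate of a code bit is an erasure, averaged over the `n`
code bits, when the other `n - 1` code bits are seen through a binary erasure channel with erasure
probability `p` and the `k` information bits through an independent one with erasure
probability `q`. -/
def extrinsicErasure (p q : ℝ) : ℝ :=
  (1 / (c.n : ℝ)) * ∑ j : Fin c.n,
    ∑ E ∈ (Finset.univ.erase j).powerset, ∑ Z ∈ (Finset.univ : Finset (Fin c.k)).powerset,
      if c.Recovers j E Z then 0
      else p ^ E.card * (1 - p) ^ (c.n - 1 - E.card) * (q ^ Z.card * (1 - q) ^ (c.k - Z.card))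

/-- EXIT function `I_E(p, q)` of a variable node with this component code under MAP decoding;
over the erasure channel the information is one minus the erasure probability. -/
def vnExit (p q : ℝ) : ℝ := 1 - c.extrinsicErasure p q

/-- EXIT function `I_E(p)` of a check node with this component code under MAP decoding: no
information bit is observed from the channel, i.e. `q = 1`. -/
def cnExit (p : ℝ) : ℝ := 1 - c.extrinsicErasure p 1

/-- Repetition code: the codewords are the constant words. -/
def IsRepetition : Prop := ∀ x, x ∈ c.codewords ↔ ∃ b : ZMod 2, x = fun _ => b

/-- Single parity-check code: the codewords are the words of even weight. -/
def IsSPC : Prop := ∀ x, x ∈ c.codewords ↔ ∑ l, x l = 0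

end ComponentCode

/-- A D-GLDPC code ensemble: finitely many variable node types and check node types, each with its
component code (and generator matrix), and the fraction of edges attached to each type. -/
structure DGLDPCEnsemble where
  /-- number of variable node types -/
  numV : ℕ
  /-- number of check node types -/
  numC : ℕ
  /-- component code of a variable node type -/
  vn : Fin numV → ComponentCode
  /-- component code of a check node type -/
  cn : Fin numC → ComponentCode
  /-- fraction of edges towards the variable nodes of a type -/
  lam : Fin numV → ℝ
  /-- fraction of edges towards the check nodes of a type -/
  rho : Fin numC → ℝ
  lam_nonneg : ∀ i, 0 ≤ lam i
  rho_nonneg : ∀ i, 0 ≤ rho i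
  lam_sum : ∑ i, lam i = 1
  rho_sum : ∑ i, rho i = 1

namespace DGLDPCEnsemble

variable (D : DGLDPCEnsemble)

/-- EXIT function of the variable node decoder. -/
def vndExit (p q : ℝ) : ℝ := ∑ i, D.lam i * (D.vn i).vnExit p q

/-- EXIT function of the check node decoder. -/
def cndExit (p : ℝ) : ℝ := ∑ i, D.rho i * (D.cn i).cnExit p

/-- Density evolution of the iterative decoder over the erasure channel with erasure probability
`q`: the erasure probability of the messages from check nodes to variable nodes after `l`
iterations. Before the first iteration all these messages are erased. -/
def erasureProb (q : ℝ) : ℕ → ℝ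
  | 0 => 1
  | l + 1 => 1 - D.cndExit (1 - D.vndExit (erasureProb q l) q)

/-- Asymptotic iterative decoding threshold `q*`: the supremum of the channel erasure
probabilities for which the message erasure probability tends to zero. -/
def threshold : ℝ :=
  sSup {q | q ∈ Set.Icc (0 : ℝ) 1 ∧
    Filter.Tendsto (D.erasureProb q) Filter.atTop (nhds 0)}

/-- The polynomial function `P`, a sum over the variable node types of minimum distance `2`. -/
def P (x : ℝ) : ℝ :=
  ∑ i with (D.vn i).minDist = 2, D.lam i *
    ∑ u ∈ Finset.Icc 1 (D.vn i).k, (2 * ((D.vn i).A2u u : ℝ) / ((D.vn i).n : ℝ)) * x ^ u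

/-- The constant `C`, a sum over the check node types of minimum distance `2`. -/
def C : ℝ :=
  ∑ i with (D.cn i).minDist = 2, D.rho i * (2 * ((D.cn i).A2 : ℝ) / ((D.cn i).n : ℝ))

/-- The inverse of `P` on the half-line `[0, ∞)`. -/
def Pinv (y : ℝ) : ℝ := Function.invFunOn D.P (Set.Ici 0) y

/-- LDPC ensemble: all variable nodes are repetition codes and all check nodes are single
parity-check codes. -/
def IsLDPC : Prop := (∀ i, (D.vn i).IsRepetition) ∧ ∀ i, (D.cn i).IsSPC

/-- Edge-perspective variable degree distribution `λ(x) = ∑ λ_i x ^ (n_i - 1)`. -/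
def lamPoly : Polynomial ℝ := ∑ i, Polynomial.C (D.lam i) * Polynomial.X ^ ((D.vn i).n - 1)

/-- Edge-perspective check degree distribution `ρ(x) = ∑ ρ_i x ^ (n_i - 1)`. -/
def rhoPoly : Polynomial ℝ := ∑ i, Polynomial.C (D.rho i) * Polynomial.X ^ ((D.cn i).n - 1)

end DGLDPCEnsemble

end

/-! In terms of erasure probabilities, density evolution iterates `h = cndErasure ∘ vndErasure q`
from the starting value `1`. Minimum distance at least `2` makes `0` a fixed point of `h`, and for
`q > 0` the orbit stays positive. A positive orbit cannot converge to a fixed point where the slope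
exceeds `1` (`not_tendsto_zero_of_one_lt_deriv`), so successful decoding forces `h'(0) = C * P q ≤
1`. Monotonicity of `P` turns this into the bound on the threshold.

The slope is computed one component code at a time (`hasDerivAt_extrinsicErasure`). To first order
in `p`, only patterns with a single erased bit `l` besides the target `j` count. Bit `j` is then
lost exactly when some codeword is supported on `{j, l}` and all nonzero information bits of its
unique generator `v` are erased, which has probability `q ^ hammingNorm v`. Each weight-2 codeword
serves two ordered pairs `(j, l)`, and averaging over `j` gives `(2 / n) * ∑ q ^ hammingNorm v`: a
summand of `P` for variable nodes, and of `C` at `q = 1`. -/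

open Finset in
theorem sum_powerset_filter_superset_pow {ι : Type*} [Fintype ι] [DecidableEq ι] (S : Finset ι)
    (q : ℝ) :
    ∑ Z ∈ (univ : Finset ι).powerset,
      (if S ⊆ Z then q ^ #Z * (1 - q) ^ (Fintype.card ι - #Z) else 0) = q ^ #S := by
  -- Split `Z` as `S ∪ T` with `T` disjoint from `S`; the sum over `T` is the binomial expansion of
  -- `(q + (1 - q)) ^ #Sᶜ = 1`.
  have h1 : ∑ T ∈ Sᶜ.powerset, q ^ #S * (q ^ #T * (1 - q) ^ (#Sᶜ - #T)) = q ^ #S := by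
    rw [← Finset.mul_sum, Finset.sum_pow_mul_eq_add_pow]
    simp
  rw [← Finset.sum_filter, ← h1]
  symm
  refine Finset.sum_bij' (fun T _ => S ∪ T) (fun Z _ => Z \ S) ?_ ?_ ?_ ?_ ?_
  · intro T _
    simp
  · intro Z _
    simp only [mem_powerset]
    intro x hx
    simp at hx ⊢
    exact hx.2
  · intro T hT
    simp only [mem_powerset] at hT
    ext x
    have := @hT x
    simp at this ⊢
    tauto
  · intro Z hZ
    simp at hZ
    exact Finset.union_sdiff_of_subset hZ
  · intro T hT
    simp only [mem_powerset] at hT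
    have hd : Disjoint S T := (Finset.subset_compl_iff_disjoint_left.mp hT)
    rw [Finset.card_union_of_disjoint hd, pow_add, Finset.card_compl, Nat.sub_sub, mul_assoc]

theorem hasDerivAt_pow_mul_one_sub_pow_zero (a b : ℕ) (ha : a ≠ 0) :
    HasDerivAt (fun p : ℝ => p ^ a * (1 - p) ^ b) (if a = 1 then 1 else 0) 0 := by
  have h1 := (hasDerivAt_pow a (0 : ℝ)).mul (((hasDerivAt_id (0 : ℝ)).const_sub 1).pow b)
  refine h1.congr_deriv ?_
  by_cases h : a = 1
  · subst h; simp
  · have : a - 1 ≠ 0 := by omega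
    simp [h, this, ha]

/-! ### Component codes: recovery criterion and bounds on the erasure probability -/

namespace ComponentCode

variable (c : ComponentCode)

theorem encode_injective : Function.Injective c.encode := by
  have : LinearIndependent (ZMod 2) c.G.row := by
    rw [linearIndependent_iff_card_eq_finrank_span, Fintype.card_fin]
    rw [Set.finrank, ← Matrix.rank_eq_finrank_span_row, c.rank_eq]
  exact Matrix.vecMul_injective_iff.mpr this

theorem encode_zero : c.encode 0 = 0 := Matrix.zero_vecMul _

theorem encode_sub (u v : Fin c.k → ZMod 2) : c.encode (u - v) = c.encode u - c.encode v :=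
  Matrix.sub_vecMul _ _ _

theorem encode_eq_zero_iff {v : Fin c.k → ZMod 2} : c.encode v = 0 ↔ v = 0 := by
  rw [← c.encode_zero, c.encode_injective.eq_iff]

/-- The positions of the nonzero information bits. -/
def infoSupport (v : Fin c.k → ZMod 2) : Finset (Fin c.k) := {m | v m ≠ 0}

theorem card_infoSupport (v : Fin c.k → ZMod 2) : (c.infoSupport v).card = hammingNorm v := rfl

/-- By linearity, the difference of two confusable information words is a single word confusable
with `0`. -/
theorem not_recovers_iff (j : Fin c.n) (E : Finset (Fin c.n)) (Z : Finset (Fin c.k)) :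
    ¬ c.Recovers j E Z ↔
      ∃ v, (∀ l, l ≠ j → l ∉ E → c.encode v l = 0) ∧ c.infoSupport v ⊆ Z ∧ c.encode v j ≠ 0 := by
  constructor
  · intro h
    simp only [Recovers, not_forall] at h
    obtain ⟨u, v, h1, h2, h3⟩ := h
    refine ⟨u - v, fun l hl hE => ?_, fun m hm => ?_, ?_⟩
    · rw [encode_sub, Pi.sub_apply, h1 l hl hE, sub_self]
    · by_contra hZ
      simp [infoSupport, h2 m hZ] at hm
    · rw [encode_sub, Pi.sub_apply]
      exact sub_ne_zero.mpr h3
  · rintro ⟨v, h1, h2, h3⟩ h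
    refine h3 ?_
    have := h v 0 (fun l hl hE => by simp [encode_zero, h1 l hl hE]) (fun m hm => ?_)
    · simpa [encode_zero] using this
    · by_contra hne
      exact hm (h2 (by simpa [infoSupport] using hne))

open Classical in
/-- Probability that code bit `j` is not recovered when exactly the other code bits in `E` are
erased and the information bits are erased independently with probability `q`. -/
noncomputable def bitErasure (j : Fin c.n) (E : Finset (Fin c.n)) (q : ℝ) : ℝ :=
  ∑ Z ∈ (Finset.univ : Finset (Fin c.k)).powerset,
    if c.Recovers j E Z then 0 else q ^ Z.card * (1 - q) ^ (c.k - Z.card)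

theorem extrinsicErasure_eq (p q : ℝ) :
    c.extrinsicErasure p q = (1 / (c.n : ℝ)) * ∑ j : Fin c.n,
      ∑ E ∈ (Finset.univ.erase j).powerset,
        p ^ E.card * (1 - p) ^ (c.n - 1 - E.card) * c.bitErasure j E q := by
  simp only [extrinsicErasure, bitErasure, Finset.mul_sum, mul_ite, mul_zero]

theorem bitErasure_nonneg (j : Fin c.n) (E : Finset (Fin c.n)) {q : ℝ} (h0 : 0 ≤ q) (h1 : q ≤ 1) :
    0 ≤ c.bitErasure j E q := by
  have := sub_nonneg.mpr h1
  refine Finset.sum_nonneg fun Z _ => ?_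
  split_ifs <;> positivity

theorem bitErasure_le_one (j : Fin c.n) (E : Finset (Fin c.n)) {q : ℝ} (h0 : 0 ≤ q)
    (h1 : q ≤ 1) : c.bitErasure j E q ≤ 1 := by
  have := sub_nonneg.mpr h1
  have h := sum_powerset_filter_superset_pow (∅ : Finset (Fin c.k)) q
  simp only [Finset.empty_subset, if_true, Finset.card_empty, pow_zero, Fintype.card_fin] at h
  rw [← h]
  refine Finset.sum_le_sum fun Z _ => ?_
  split_ifs
  · positivity
  · exact le_rfl

theorem sum_pow_mul_one_sub_pow_erase (j : Fin c.n) (p : ℝ) :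
    ∑ E ∈ (Finset.univ.erase j).powerset, p ^ E.card * (1 - p) ^ (c.n - 1 - E.card) = 1 := by
  have h := Finset.sum_pow_mul_eq_add_pow p (1 - p) (Finset.univ.erase j)
  rw [Finset.card_erase_of_mem (Finset.mem_univ j), Finset.card_univ, Fintype.card_fin] at h
  rw [h]
  simp

theorem extrinsicErasure_le_one {p q : ℝ} (hp0 : 0 ≤ p) (hp1 : p ≤ 1) (hq0 : 0 ≤ q)
    (hq1 : q ≤ 1) : c.extrinsicErasure p q ≤ 1 := by
  rw [extrinsicErasure_eq]
  have := sub_nonneg.mpr hp1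
  have hj : ∀ j ∈ (Finset.univ : Finset (Fin c.n)), ∑ E ∈ (Finset.univ.erase j).powerset,
        p ^ E.card * (1 - p) ^ (c.n - 1 - E.card) * c.bitErasure j E q ≤ 1 := fun j _ => by
    refine le_of_le_of_eq (Finset.sum_le_sum fun E _ => ?_) (c.sum_pow_mul_one_sub_pow_erase j p)
    exact mul_le_of_le_one_right (by positivity) (c.bitErasure_le_one j E hq0 hq1)
  calc _ ≤ (1 / (c.n : ℝ)) * ∑ j : Fin c.n, 1 :=
        mul_le_mul_of_nonneg_left (Finset.sum_le_sum hj) (by positivity)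
    _ ≤ 1 := by
        simp only [Finset.sum_const, Finset.card_univ, Fintype.card_fin, nsmul_eq_mul, mul_one]
        rw [one_div]
        exact inv_mul_le_one

theorem exists_encode_apply_ne_zero : ∃ v j, c.encode v j ≠ 0 := by
  have : encode c (Pi.single ⟨0, c.k_pos⟩ 1) ≠ 0 := by
    rw [Ne, encode_eq_zero_iff]
    simp
  obtain ⟨j, hj⟩ := Function.ne_iff.mp this
  exact ⟨_, j, hj⟩

theorem extrinsicErasure_pos {p q : ℝ} (hp0 : 0 < p) (hp1 : p ≤ 1) (hq0 : 0 < q)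
    (hq1 : q ≤ 1) : 0 < c.extrinsicErasure p q := by
  obtain ⟨v, j, hv⟩ := c.exists_encode_apply_ne_zero
  have hn : 0 < (c.n : ℝ) := by exact_mod_cast j.pos
  have hp := sub_nonneg.mpr hp1
  have hq := sub_nonneg.mpr hq1
  rw [extrinsicErasure_eq]
  have hterm : ∀ (j : Fin c.n) (E : Finset (Fin c.n)),
      0 ≤ p ^ E.card * (1 - p) ^ (c.n - 1 - E.card) * c.bitErasure j E q := fun j E =>
    mul_nonneg (by positivity) (c.bitErasure_nonneg j E hq0.le hq1)
  refine mul_pos (by positivity) (Finset.sum_pos'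
    (fun j _ => Finset.sum_nonneg fun E _ => hterm j E) ⟨j, Finset.mem_univ j, ?_⟩)
  -- The pattern erasing all other code bits and all information bits has positive probability, and
  -- bit `j` is not constantly zero.
  refine Finset.sum_pos' (fun E _ => hterm j E)
    ⟨Finset.univ.erase j, Finset.mem_powerset_self _, ?_⟩
  rw [Finset.card_erase_of_mem (Finset.mem_univ j), Finset.card_univ, Fintype.card_fin,
    Nat.sub_self, pow_zero, mul_one]
  refine mul_pos (by positivity) ?_
  refine Finset.sum_pos' (fun Z _ => ?_) ⟨Finset.univ, Finset.mem_powerset_self _, ?_⟩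
  · split_ifs <;> positivity
  · have : ¬ c.Recovers j (Finset.univ.erase j) Finset.univ :=
      (c.not_recovers_iff _ _ _).mpr ⟨v, fun l hl hE => absurd hl (by simpa using hE),
        Finset.subset_univ _, hv⟩
    rw [if_neg this, Finset.card_univ, Fintype.card_fin, Nat.sub_self, pow_zero, mul_one]
    positivity

/-! ### Weight-2 codewords and the slope at the origin -/

/-- The information words that generate codewords of Hamming weight `2`. -/
def weightTwoWords : Finset (Fin c.k → ZMod 2) := {v | hammingNorm (c.encode v) = 2}

theorem mem_weightTwoWords {v : Fin c.k → ZMod 2} :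
    v ∈ c.weightTwoWords ↔ hammingNorm (c.encode v) = 2 := by simp [weightTwoWords]

/-- Generating function, by information weight, of the codewords of weight `2`. -/
noncomputable def weightTwoEnum (x : ℝ) : ℝ := ∑ v ∈ c.weightTwoWords, x ^ hammingNorm v

theorem A2u_eq (u : ℕ) : c.A2u u = (c.weightTwoWords.filter fun v => hammingNorm v = u).card := by
  rw [← Finset.card_image_of_injective _ c.encode_injective, ← Set.ncard_coe_finset, A2u]
  congr 1
  ext x
  simp only [Set.mem_ofPred_eq, Finset.coe_image, Finset.coe_filter, mem_weightTwoWords,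
    Set.mem_image]
  constructor
  · rintro ⟨h, v, hv, rfl⟩
    exact ⟨v, ⟨h, hv⟩, rfl⟩
  · rintro ⟨v, ⟨h, hv⟩, rfl⟩
    exact ⟨h, v, hv, rfl⟩

theorem A2_eq : c.A2 = c.weightTwoWords.card := by
  rw [← Finset.card_image_of_injective _ c.encode_injective, ← Set.ncard_coe_finset, A2]
  congr 1
  ext x
  simp only [Set.mem_ofPred_eq, Finset.coe_image, Finset.mem_coe, mem_weightTwoWords,
    Set.mem_image, codewords, Set.mem_range]
  constructor
  · rintro ⟨⟨v, rfl⟩, h⟩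
    exact ⟨v, h, rfl⟩
  · rintro ⟨v, h, rfl⟩
    exact ⟨⟨v, rfl⟩, h⟩

theorem hammingNorm_mem_Icc {v : Fin c.k → ZMod 2} (hv : v ∈ c.weightTwoWords) :
    hammingNorm v ∈ Finset.Icc 1 c.k := by
  rw [Finset.mem_Icc]
  constructor
  · rw [Nat.one_le_iff_ne_zero, Ne, hammingNorm_eq_zero]
    rintro rfl
    simp [mem_weightTwoWords, encode_zero] at hv
  · simpa using hammingNorm_le_card_fintype (x := v)

theorem sum_A2u_mul_pow (x : ℝ) :
    ∑ u ∈ Finset.Icc 1 c.k, (2 * (c.A2u u : ℝ) / (c.n : ℝ)) * x ^ u =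
      2 / (c.n : ℝ) * c.weightTwoEnum x := by
  rw [weightTwoEnum, ← Finset.sum_fiberwise_of_maps_to (fun v hv => c.hammingNorm_mem_Icc hv),
    Finset.mul_sum]
  refine Finset.sum_congr rfl fun u _ => ?_
  rw [Finset.sum_congr rfl (g := fun _ => x ^ u)
    (fun v hv => by rw [(Finset.mem_filter.mp hv).2]), Finset.sum_const, A2u_eq, nsmul_eq_mul]
  ring

theorem weightTwoEnum_one : c.weightTwoEnum 1 = c.A2 := by
  simp [weightTwoEnum, A2_eq]

theorem minDist_le {v : Fin c.k → ZMod 2} (hv : v ≠ 0) : c.minDist ≤ hammingNorm (c.encode v) :=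
  Nat.sInf_le ⟨c.encode v, ⟨v, rfl⟩, by rwa [Ne, encode_eq_zero_iff], rfl⟩

theorem exists_hammingNorm_eq_minDist :
    ∃ v : Fin c.k → ZMod 2, v ≠ 0 ∧ hammingNorm (c.encode v) = c.minDist := by
  obtain ⟨v, j, hv⟩ := c.exists_encode_apply_ne_zero
  have hne : {w | ∃ x ∈ c.codewords, x ≠ 0 ∧ hammingNorm x = w}.Nonempty :=
    ⟨_, c.encode v, ⟨v, rfl⟩, fun h => hv (by rw [h]; rfl), rfl⟩
  obtain ⟨_, ⟨u, rfl⟩, hu, h⟩ := Nat.sInf_mem hne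
  exact ⟨u, by rwa [Ne, encode_eq_zero_iff] at hu, h⟩

theorem weightTwoWords_nonempty (h : c.minDist = 2) : c.weightTwoWords.Nonempty := by
  obtain ⟨v, _, hv⟩ := c.exists_hammingNorm_eq_minDist
  exact ⟨v, c.mem_weightTwoWords.mpr (hv.trans h)⟩

theorem weightTwoWords_eq_empty (h : 2 < c.minDist) : c.weightTwoWords = ∅ := by
  refine Finset.eq_empty_of_forall_notMem fun v hv => ?_
  have h2 := c.mem_weightTwoWords.mp hv
  have hv0 : v ≠ 0 := by
    rintro rfl
    simp [encode_zero] at h2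
  have := c.minDist_le hv0
  omega

theorem minDist_le_length : c.minDist ≤ c.n := by
  obtain ⟨v, _, hv⟩ := c.exists_hammingNorm_eq_minDist
  rw [← hv]
  simpa using hammingNorm_le_card_fintype (x := c.encode v)

/-- A failure here would produce a nonzero codeword supported on `{j}`, of weight below the minimum
distance. -/
theorem bitErasure_empty (h : 2 ≤ c.minDist) (j : Fin c.n) (q : ℝ) :
    c.bitErasure j ∅ q = 0 := by
  refine Finset.sum_eq_zero fun Z _ => if_pos ?_
  by_contra hr
  obtain ⟨v, h1, -, h3⟩ := (c.not_recovers_iff _ _ _).mp hr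
  have hv0 : v ≠ 0 := by
    rintro rfl
    simp [encode_zero] at h3
  have h4 := c.minDist_le hv0
  have h5 : hammingNorm (c.encode v) ≤ ({j} : Finset (Fin c.n)).card := by
    refine Finset.card_le_card fun l hl => ?_
    by_contra hlj
    exact (Finset.mem_filter.mp hl).2 (h1 l (by simpa using hlj) (by simp))
  simp at h5
  omega

-- A witness of failure is supported in `{j, l}`, and minimum distance at least `2` forces its
-- support to be the whole pair.
open Finset in
theorem not_recovers_singleton_iff (h : 2 ≤ c.minDist) {j l : Fin c.n} (hl : l ≠ j)
    (Z : Finset (Fin c.k)) :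
    ¬ c.Recovers j {l} Z ↔ ∃ v ∈ c.weightTwoWords,
      (c.encode v j ≠ 0 ∧ c.encode v l ≠ 0) ∧ c.infoSupport v ⊆ Z := by
  rw [not_recovers_iff]
  constructor
  · rintro ⟨v, h1, h2, h3⟩
    have hv0 : v ≠ 0 := by
      rintro rfl
      simp [encode_zero] at h3
    have hsub : ({i | c.encode v i ≠ 0} : Finset (Fin c.n)) ⊆ {j, l} := fun i hi => by
      by_contra hil
      simp only [mem_insert, mem_singleton, not_or] at hil
      exact (mem_filter.mp hi).2 (h1 i hil.1 (by simpa using hil.2))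
    have hcard : #({j, l} : Finset (Fin c.n)) = 2 := card_pair hl.symm
    have hge : 2 ≤ #({i | c.encode v i ≠ 0} : Finset (Fin c.n)) := h.trans (c.minDist_le hv0)
    have heq := eq_of_subset_of_card_le hsub (hcard.trans_le hge)
    refine ⟨v, c.mem_weightTwoWords.mpr ?_, ⟨h3, ?_⟩, h2⟩
    · change #({i | c.encode v i ≠ 0} : Finset (Fin c.n)) = 2
      rw [heq, hcard]
    · have : l ∈ ({i | c.encode v i ≠ 0} : Finset (Fin c.n)) := by simp [heq]
      exact (mem_filter.mp this).2
  · rintro ⟨v, hv, ⟨hj, hl'⟩, hZ⟩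
    refine ⟨v, fun i hij hil => ?_, hZ, hj⟩
    by_contra hi
    have h3 : #({j, l, i} : Finset (Fin c.n)) ≤ hammingNorm (c.encode v) := by
      refine card_le_card fun x hx => ?_
      simp only [mem_insert, mem_singleton] at hx
      rcases hx with rfl | rfl | rfl <;> simpa
    rw [c.mem_weightTwoWords.mp hv, card_eq_three.mpr
      ⟨j, l, i, hl.symm, hij.symm, fun e => hil (by simp [e]), rfl⟩] at h3
    omega

/-- Over `ZMod 2` the support determines the codeword. This uniqueness means no inclusion-exclusion
is needed when computing the failure probability. -/
theorem eq_of_mem_weightTwoWords {v w : Fin c.k → ZMod 2} {j l : Fin c.n} (hl : l ≠ j)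
    (hv : v ∈ c.weightTwoWords) (hw : w ∈ c.weightTwoWords)
    (hv' : c.encode v j ≠ 0 ∧ c.encode v l ≠ 0) (hw' : c.encode w j ≠ 0 ∧ c.encode w l ≠ 0) :
    v = w := by
  apply c.encode_injective
  have key : ∀ u : Fin c.k → ZMod 2, u ∈ c.weightTwoWords → c.encode u j ≠ 0 → c.encode u l ≠ 0 →
      ∀ i, c.encode u i = if i = j ∨ i = l then 1 else 0 := by
    intro u hu hj hl' i
    have hsub : ({j, l} : Finset (Fin c.n)) ⊆ ({i | c.encode u i ≠ 0} : Finset (Fin c.n)) := by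
      intro x hx
      simp only [Finset.mem_insert, Finset.mem_singleton] at hx
      rcases hx with rfl | rfl <;> simpa
    have hle : ({i | c.encode u i ≠ 0} : Finset (Fin c.n)).card ≤
        ({j, l} : Finset (Fin c.n)).card := by
      rw [Finset.card_pair hl.symm]
      exact (c.mem_weightTwoWords.mp hu).le
    have heq := Finset.eq_of_subset_of_card_le hsub hle
    have hi : i ∈ ({j, l} : Finset (Fin c.n)) ↔ c.encode u i ≠ 0 := by simp [heq]
    simp only [Finset.mem_insert, Finset.mem_singleton] at hi
    split_ifs with hc
    · exact Fin.eq_one_of_ne_zero _ (hi.mp hc)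
    · by_contra h
      exact hc (hi.mpr h)
  ext i
  rw [key v hv hv'.1 hv'.2, key w hw hw'.1 hw'.2]

theorem bitErasure_singleton (h : 2 ≤ c.minDist) {j l : Fin c.n} (hl : l ≠ j) (q : ℝ) :
    c.bitErasure j {l} q = ∑ v ∈ c.weightTwoWords,
      if c.encode v j ≠ 0 ∧ c.encode v l ≠ 0 then q ^ hammingNorm v else 0 := by
  classical
  by_cases hex : ∃ v ∈ c.weightTwoWords, c.encode v j ≠ 0 ∧ c.encode v l ≠ 0
  · obtain ⟨v, hv, hv'⟩ := hex
    have hr : ∀ Z, ¬ c.Recovers j {l} Z ↔ c.infoSupport v ⊆ Z := fun Z => by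
      rw [c.not_recovers_singleton_iff h hl]
      constructor
      · rintro ⟨w, hw, hw', hZ⟩
        rwa [c.eq_of_mem_weightTwoWords hl hv hw hv' hw']
      · exact fun hZ => ⟨v, hv, hv', hZ⟩
    rw [Finset.sum_eq_single_of_mem v hv, if_pos hv', ← card_infoSupport,
      ← sum_powerset_filter_superset_pow, bitErasure]
    · refine Finset.sum_congr rfl fun Z _ => ?_
      rw [Fintype.card_fin]
      by_cases hZ : c.infoSupport v ⊆ Z
      · rw [if_pos hZ, if_neg ((hr Z).mpr hZ)]
      · rw [if_neg hZ, if_pos (not_not.mp ((hr Z).not.mpr hZ))]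
    · exact fun w hw hne => if_neg fun hw' =>
        hne (c.eq_of_mem_weightTwoWords hl hw hv hw' hv')
  · push Not at hex
    rw [Finset.sum_eq_zero fun v hv => if_neg fun hv' => hv'.2 (hex v hv hv'.1)]
    refine Finset.sum_eq_zero fun Z _ => if_pos ?_
    by_contra hr
    obtain ⟨v, hv, hv', -⟩ := (c.not_recovers_singleton_iff h hl Z).mp hr
    exact hv'.2 (hex v hv hv'.1)

open Finset in
theorem sum_bitErasure_singleton (h : 2 ≤ c.minDist) (q : ℝ) :
    ∑ j : Fin c.n, ∑ l ∈ univ.erase j, c.bitErasure j {l} q = 2 * c.weightTwoEnum q := by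
  have h1 : ∀ j : Fin c.n, ∑ l ∈ univ.erase j, c.bitErasure j {l} q =
      ∑ v ∈ c.weightTwoWords, ∑ l ∈ univ.erase j,
        if c.encode v j ≠ 0 ∧ c.encode v l ≠ 0 then q ^ hammingNorm v else 0 := fun j => by
    rw [sum_comm]
    exact sum_congr rfl fun l hl => c.bitErasure_singleton h (ne_of_mem_erase hl) q
  rw [sum_congr rfl fun j _ => h1 j, sum_comm, weightTwoEnum, mul_sum]
  refine sum_congr rfl fun v hv => ?_
  have hc : #({i | c.encode v i ≠ 0} : Finset (Fin c.n)) = 2 := c.mem_weightTwoWords.mp hv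
  -- For each `j` in the support of `encode v`, exactly one other position `l` remains; the two
  -- choices of `j` give the factor `2`.
  have h2 : ∀ j : Fin c.n, (∑ l ∈ univ.erase j,
      if c.encode v j ≠ 0 ∧ c.encode v l ≠ 0 then q ^ hammingNorm v else 0) =
      if c.encode v j ≠ 0 then q ^ hammingNorm v else 0 := fun j => by
    by_cases hj : c.encode v j = 0
    · simp [hj]
    · have he : ({l ∈ univ.erase j | c.encode v l ≠ 0}) =
          ({i | c.encode v i ≠ 0} : Finset (Fin c.n)).erase j := by
        ext; simp
      simp only [ne_eq, hj, not_false_eq_true, true_and, if_true]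
      rw [← sum_filter, sum_const, he, card_erase_of_mem (by simpa using hj), hc, one_nsmul]
  rw [sum_congr rfl fun j _ => h2 j, ← sum_filter, sum_const, hc, nsmul_eq_mul, Nat.cast_ofNat]

/-- Slope at the origin of the erasure probability of a component code. -/
theorem hasDerivAt_extrinsicErasure (h : 2 ≤ c.minDist) (q : ℝ) :
    HasDerivAt (fun p => c.extrinsicErasure p q) (2 / (c.n : ℝ) * c.weightTwoEnum q) 0 := by
  simp only [extrinsicErasure_eq]
  have hE : ∀ (j : Fin c.n) (E : Finset (Fin c.n)),
      HasDerivAt (fun p : ℝ => p ^ E.card * (1 - p) ^ (c.n - 1 - E.card) * c.bitErasure j E q)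
        (if E.card = 1 then c.bitErasure j E q else 0) 0 := fun j E => by
    rcases E.eq_empty_or_nonempty with rfl | hne
    · simpa [c.bitErasure_empty h] using hasDerivAt_const (0 : ℝ) (0 : ℝ)
    · refine ((hasDerivAt_pow_mul_one_sub_pow_zero _ _ hne.card_ne_zero).mul_const
        (c.bitErasure j E q)).congr_deriv ?_
      split_ifs <;> simp
  refine ((HasDerivAt.fun_sum fun j _ => HasDerivAt.fun_sum fun E _ => hE j E).const_mul
    (1 / (c.n : ℝ))).congr_deriv ?_
  have hs : ∀ j : Fin c.n, (∑ E ∈ (Finset.univ.erase j).powerset,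
      if E.card = 1 then c.bitErasure j E q else 0) =
      ∑ l ∈ Finset.univ.erase j, c.bitErasure j {l} q := fun j => by
    rw [← Finset.sum_filter, ← Finset.powersetCard_eq_filter, Finset.powersetCard_one,
      Finset.sum_map]
    rfl
  rw [Finset.sum_congr rfl fun j _ => hs j, c.sum_bitErasure_singleton h]
  ring

theorem extrinsicErasure_zero (h : 2 ≤ c.minDist) (q : ℝ) : c.extrinsicErasure 0 q = 0 := by
  rw [extrinsicErasure_eq]
  refine mul_eq_zero_of_right _ (Finset.sum_eq_zero fun j _ => Finset.sum_eq_zero fun E _ => ?_)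
  rcases E.eq_empty_or_nonempty with rfl | hne
  · rw [c.bitErasure_empty h, mul_zero]
  · rw [zero_pow hne.card_ne_zero, zero_mul, zero_mul]

/-! ### Repetition and single parity-check codes -/

theorem IsRepetition.minDist_eq {c : ComponentCode} (hc : c.IsRepetition) : c.minDist = c.n := by
  obtain ⟨v, hv0, hv⟩ := c.exists_hammingNorm_eq_minDist
  obtain ⟨b, hb⟩ := (hc _).mp ⟨v, rfl⟩
  rw [← hv]
  have hb0 : b ≠ 0 := by
    rintro rfl
    exact hv0 (c.encode_eq_zero_iff.mp hb)
  simp [hb, hammingNorm, hb0]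

theorem IsRepetition.encode_eq_one {c : ComponentCode} (hc : c.IsRepetition)
    {v : Fin c.k → ZMod 2} (hv : v ≠ 0) : c.encode v = fun _ => 1 := by
  obtain ⟨b, hb⟩ := (hc _).mp ⟨v, rfl⟩
  have hb0 : b ≠ 0 := by
    rintro rfl
    exact hv (c.encode_eq_zero_iff.mp hb)
  rw [hb]
  exact funext fun _ => Fin.eq_one_of_ne_zero b hb0

theorem IsRepetition.weightTwoEnum_eq {c : ComponentCode} (hc : c.IsRepetition) (hn : c.n = 2)
    (x : ℝ) : c.weightTwoEnum x = x := by
  -- All nonzero information words encode to the all-ones word, so by injectivity this unit vector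
  -- is the only one.
  set e : Fin c.k → ZMod 2 := Pi.single ⟨0, c.k_pos⟩ 1 with he
  have he0 : e ≠ 0 := by simp [he]
  have hW : c.weightTwoWords = {e} := by
    ext v
    rw [mem_weightTwoWords, Finset.mem_singleton]
    constructor
    · intro h
      have hv : v ≠ 0 := by
        rintro rfl
        simp [encode_zero] at h
      exact c.encode_injective ((hc.encode_eq_one hv).trans (hc.encode_eq_one he0).symm)
    · rintro rfl
      simp [hc.encode_eq_one he0, hammingNorm, hn]
  have hnorm : hammingNorm e = 1 := by
    rw [hammingNorm, Finset.card_eq_one]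
    refine ⟨⟨0, c.k_pos⟩, ?_⟩
    ext m
    by_cases hm : m = ⟨0, c.k_pos⟩ <;> simp [he, hm, Pi.single_apply]
  rw [weightTwoEnum, hW, Finset.sum_singleton, hnorm, pow_one]

open Finset in
theorem IsSPC.A2_eq_choose {c : ComponentCode} (hc : c.IsSPC) : c.A2 = c.n.choose 2 := by
  have h1 : #(powersetCard 2 (univ : Finset (Fin c.n))) = c.n.choose 2 := by simp
  rw [← h1, ← Set.ncard_coe_finset, A2]
  refine Set.ncard_congr (fun x _ => ({i | x i ≠ 0} : Finset (Fin c.n))) ?_ ?_ ?_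
  · rintro x ⟨-, hx⟩
    exact mem_powersetCard.mpr ⟨subset_univ _, hx⟩
  · intro x y _ _ hxy
    ext i
    have hi : x i ≠ 0 ↔ y i ≠ 0 := by
      have := Finset.ext_iff.mp hxy i
      simpa only [mem_filter_univ] using this
    by_cases hx : x i = 0
    · rw [hx, not_not.mp (hi.not.mp (not_not.mpr hx))]
    · rw [Fin.eq_one_of_ne_zero _ hx, Fin.eq_one_of_ne_zero _ (hi.mp hx)]
  · intro S hS
    have hS2 : #S = 2 := (mem_powersetCard.mp hS).2
    refine ⟨fun i => if i ∈ S then 1 else 0, ⟨(hc _).mpr ?_, ?_⟩, ?_⟩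
    · simp [hS2]
      rfl
    · simp [hammingNorm, hS2]
    · ext i
      simp

theorem IsSPC.minDist_eq_two {c : ComponentCode} (hc : c.IsSPC) (h : 2 ≤ c.minDist) :
    c.minDist = 2 := by
  by_contra hne
  have h0 := c.weightTwoWords_eq_empty (by omega)
  have h1 := hc.A2_eq_choose
  rw [A2_eq, h0, Finset.card_empty] at h1
  exact (Nat.choose_pos (h.trans c.minDist_le_length)).ne h1

theorem IsSPC.two_mul_A2_div {c : ComponentCode} (hc : c.IsSPC) (h : 2 ≤ c.minDist) :
    2 * (c.A2 : ℝ) / (c.n : ℝ) = (c.n : ℝ) - 1 := by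
  have hn : (c.n : ℝ) ≠ 0 := by
    have := h.trans c.minDist_le_length
    exact_mod_cast (by omega : c.n ≠ 0)
  rw [hc.A2_eq_choose, Nat.cast_choose_two]
  field_simp

end ComponentCode

/-! ### The polynomial `P` and the constant `C` -/

namespace DGLDPCEnsemble

variable (D : DGLDPCEnsemble)

/-- Types with minimum distance above `2` have no weight-2 words, so the restriction on the sum can
be dropped. -/
theorem P_eq (hvn : ∀ i, 2 ≤ (D.vn i).minDist) (x : ℝ) :
    D.P x = ∑ i, D.lam i * (2 / ((D.vn i).n : ℝ) * (D.vn i).weightTwoEnum x) := by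
  rw [P, Finset.sum_filter]
  refine Finset.sum_congr rfl fun i _ => ?_
  rw [ComponentCode.sum_A2u_mul_pow]
  split_ifs with h
  · rfl
  · rw [ComponentCode.weightTwoEnum,
      ComponentCode.weightTwoWords_eq_empty _ (lt_of_le_of_ne (hvn i) (Ne.symm h))]
    simp

theorem C_eq (hcn : ∀ i, 2 ≤ (D.cn i).minDist) :
    D.C = ∑ i, D.rho i * (2 / ((D.cn i).n : ℝ) * (D.cn i).weightTwoEnum 1) := by
  rw [C, Finset.sum_filter]
  refine Finset.sum_congr rfl fun i _ => ?_
  split_ifs with h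
  · rw [ComponentCode.weightTwoEnum_one]
    ring
  · rw [ComponentCode.weightTwoEnum,
      ComponentCode.weightTwoWords_eq_empty _ (lt_of_le_of_ne (hcn i) (Ne.symm h))]
    simp

theorem C_pos (hcn : ∀ i, 2 ≤ (D.cn i).minDist)
    (hC : ∃ i, (D.cn i).minDist = 2 ∧ 0 < D.rho i) : 0 < D.C := by
  obtain ⟨i, hi, hrho⟩ := hC
  rw [C_eq D hcn]
  simp only [ComponentCode.weightTwoEnum_one]
  refine Finset.sum_pos' (fun i _ => mul_nonneg (D.rho_nonneg i) (by positivity))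
    ⟨i, Finset.mem_univ i, mul_pos hrho ?_⟩
  have h1 : 0 < (D.cn i).A2 := by
    rw [ComponentCode.A2_eq]
    exact ((D.cn i).weightTwoWords_nonempty hi).card_pos
  have h2 : 0 < (D.cn i).n := by
    have := (D.cn i).minDist_le_length
    omega
  positivity

theorem strictMonoOn_P (hvn : ∀ i, 2 ≤ (D.vn i).minDist)
    (hP : ∃ i, (D.vn i).minDist = 2 ∧ 0 < D.lam i) : StrictMonoOn D.P (Set.Ici 0) := by
  obtain ⟨i, hi, hlam⟩ := hP
  intro x hx y _ hxy
  have hx : 0 ≤ x := hx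
  have hn : 0 < ((D.vn i).n : ℝ) := by
    have := (D.vn i).minDist_le_length
    exact_mod_cast (by omega : 0 < (D.vn i).n)
  rw [P_eq D hvn, P_eq D hvn]
  refine Finset.sum_lt_sum (fun i _ => mul_le_mul_of_nonneg_left (mul_le_mul_of_nonneg_left
    (Finset.sum_le_sum fun v _ => pow_le_pow_left₀ hx hxy.le _) (by positivity)) (D.lam_nonneg i))
    ⟨i, Finset.mem_univ i, mul_lt_mul_of_pos_left (mul_lt_mul_of_pos_left
      (Finset.sum_lt_sum_of_nonempty ((D.vn i).weightTwoWords_nonempty hi) fun v hv => ?_)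
      (by positivity)) hlam⟩
  have := (Finset.mem_Icc.mp ((D.vn i).hammingNorm_mem_Icc hv)).1
  exact pow_lt_pow_left₀ hxy hx (by omega)

theorem continuous_P : Continuous D.P := by
  unfold P
  fun_prop

theorem P_zero : D.P 0 = 0 := by
  refine Finset.sum_eq_zero fun i _ => mul_eq_zero_of_right _ (Finset.sum_eq_zero fun u hu => ?_)
  have := (Finset.mem_Icc.mp hu).1
  rw [zero_pow (by omega), mul_zero]

/-- All exponents are at least `1`, so `P` grows at least linearly; this yields surjectivity through
the intermediate value theorem. -/
theorem mul_P_one_le (hvn : ∀ i, 2 ≤ (D.vn i).minDist) {x : ℝ} (hx : 1 ≤ x) :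
    x * D.P 1 ≤ D.P x := by
  rw [P_eq D hvn, P_eq D hvn, Finset.mul_sum]
  refine Finset.sum_le_sum fun i _ => ?_
  rw [mul_left_comm, mul_left_comm x]
  refine mul_le_mul_of_nonneg_left (mul_le_mul_of_nonneg_left ?_ (by positivity)) (D.lam_nonneg i)
  rw [ComponentCode.weightTwoEnum, ComponentCode.weightTwoEnum, Finset.mul_sum]
  refine Finset.sum_le_sum fun v hv => ?_
  have := (Finset.mem_Icc.mp ((D.vn i).hammingNorm_mem_Icc hv)).1
  rw [one_pow, mul_one]
  exact le_self_pow₀ hx (by omega)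

theorem bijOn_P (hvn : ∀ i, 2 ≤ (D.vn i).minDist)
    (hP : ∃ i, (D.vn i).minDist = 2 ∧ 0 < D.lam i) :
    Set.BijOn D.P (Set.Ici 0) (Set.Ici 0) := by
  have hmono := D.strictMonoOn_P hvn hP
  refine ⟨fun x hx => ?_, hmono.injOn, fun y hy => ?_⟩
  · have := hmono.monotoneOn (Set.mem_Ici.mpr le_rfl) hx hx
    rwa [P_zero] at this
  · have hy : 0 ≤ y := hy
    have h1 : 0 < D.P 1 := by
      have := hmono (Set.mem_Ici.mpr le_rfl) (Set.mem_Ici.mpr zero_le_one) zero_lt_one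
      rwa [P_zero] at this
    set M := max 1 (y / D.P 1)
    have hM1 : 1 ≤ M := le_max_left _ _
    have hM : y ≤ D.P M := by
      refine le_trans ?_ (D.mul_P_one_le hvn hM1)
      rw [← div_le_iff₀ h1]
      exact le_max_right _ _
    obtain ⟨x, hx, hxy⟩ := intermediate_value_Icc (zero_le_one.trans hM1)
      D.continuous_P.continuousOn (show y ∈ Set.Icc (D.P 0) (D.P M) from ⟨by rwa [P_zero], hM⟩)
    exact ⟨x, hx.1, hxy⟩

/-! ### Density evolution and the stability bound -/

/-- Erasure probability of the messages sent by the variable nodes. -/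
noncomputable def vndErasure (q p : ℝ) : ℝ := ∑ i, D.lam i * (D.vn i).extrinsicErasure p q

/-- Erasure probability of the messages sent by the check nodes. -/
noncomputable def cndErasure (p : ℝ) : ℝ := ∑ i, D.rho i * (D.cn i).extrinsicErasure p 1

theorem one_sub_vndExit (p q : ℝ) : 1 - D.vndExit p q = D.vndErasure q p := by
  simp only [vndExit, vndErasure, ComponentCode.vnExit, mul_sub, mul_one, Finset.sum_sub_distrib,
    D.lam_sum]
  ring

theorem one_sub_cndExit (p : ℝ) : 1 - D.cndExit p = D.cndErasure p := by
  simp only [cndExit, cndErasure, ComponentCode.cnExit, mul_sub, mul_one, Finset.sum_sub_distrib,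
    D.rho_sum]
  ring

theorem erasureProb_succ (q : ℝ) (l : ℕ) :
    D.erasureProb q (l + 1) = D.cndErasure (D.vndErasure q (D.erasureProb q l)) := by
  rw [erasureProb, one_sub_vndExit, one_sub_cndExit]

theorem _root_.sum_weight_mul_mem_Ioc {ι : Type*} [Fintype ι] {w f : ι → ℝ} (hw : ∀ i, 0 ≤ w i)
    (hsum : ∑ i, w i = 1) (hf : ∀ i, f i ∈ Set.Ioc (0 : ℝ) 1) :
    ∑ i, w i * f i ∈ Set.Ioc (0 : ℝ) 1 := by
  constructor
  · obtain ⟨i, -, hi⟩ := Finset.exists_ne_zero_of_sum_ne_zero (hsum.trans_ne one_ne_zero)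
    exact Finset.sum_pos' (fun i _ => mul_nonneg (hw i) (hf i).1.le)
      ⟨i, Finset.mem_univ i, mul_pos (lt_of_le_of_ne (hw i) (Ne.symm hi)) (hf i).1⟩
  · rw [← hsum]
    exact Finset.sum_le_sum fun i _ => mul_le_of_le_one_right (hw i) (hf i).2

theorem vndErasure_mem {p q : ℝ} (hp : p ∈ Set.Ioc (0 : ℝ) 1) (hq : q ∈ Set.Ioc (0 : ℝ) 1) :
    D.vndErasure q p ∈ Set.Ioc (0 : ℝ) 1 :=
  sum_weight_mul_mem_Ioc D.lam_nonneg D.lam_sum fun _ =>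
    ⟨ComponentCode.extrinsicErasure_pos _ hp.1 hp.2 hq.1 hq.2,
      ComponentCode.extrinsicErasure_le_one _ hp.1.le hp.2 hq.1.le hq.2⟩

theorem cndErasure_mem {p : ℝ} (hp : p ∈ Set.Ioc (0 : ℝ) 1) :
    D.cndErasure p ∈ Set.Ioc (0 : ℝ) 1 :=
  sum_weight_mul_mem_Ioc D.rho_nonneg D.rho_sum fun _ =>
    ⟨ComponentCode.extrinsicErasure_pos _ hp.1 hp.2 one_pos le_rfl,
      ComponentCode.extrinsicErasure_le_one _ hp.1.le hp.2 zero_le_one le_rfl⟩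

theorem erasureProb_mem {q : ℝ} (hq : q ∈ Set.Ioc (0 : ℝ) 1) (l : ℕ) :
    D.erasureProb q l ∈ Set.Ioc (0 : ℝ) 1 := by
  induction l with
  | zero => simp [erasureProb]
  | succ l ih =>
    rw [erasureProb_succ]
    exact D.cndErasure_mem (D.vndErasure_mem ih hq)

theorem hasDerivAt_vndErasure (hvn : ∀ i, 2 ≤ (D.vn i).minDist) (q : ℝ) :
    HasDerivAt (D.vndErasure q) (D.P q) 0 := by
  rw [P_eq D hvn]
  exact HasDerivAt.fun_sum fun i _ =>
    ((D.vn i).hasDerivAt_extrinsicErasure (hvn i) q).const_mul (D.lam i)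

theorem hasDerivAt_cndErasure (hcn : ∀ i, 2 ≤ (D.cn i).minDist) :
    HasDerivAt D.cndErasure D.C 0 := by
  rw [C_eq D hcn]
  exact HasDerivAt.fun_sum fun i _ =>
    ((D.cn i).hasDerivAt_extrinsicErasure (hcn i) 1).const_mul (D.rho i)

theorem vndErasure_zero (hvn : ∀ i, 2 ≤ (D.vn i).minDist) (q : ℝ) : D.vndErasure q 0 = 0 :=
  Finset.sum_eq_zero fun i _ => by
    rw [(D.vn i).extrinsicErasure_zero (hvn i), mul_zero]

theorem cndErasure_zero (hcn : ∀ i, 2 ≤ (D.cn i).minDist) : D.cndErasure 0 = 0 :=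
  Finset.sum_eq_zero fun i _ => by
    rw [(D.cn i).extrinsicErasure_zero (hcn i), mul_zero]

/-- A positive orbit of a map with slope greater than `1` at the fixed point `0` does not tend
to `0`. -/
theorem _root_.not_tendsto_zero_of_one_lt_deriv {h : ℝ → ℝ} {m : ℝ} (hd : HasDerivAt h m 0)
    (h0 : h 0 = 0) (hm : 1 < m) {a : ℕ → ℝ} (ha : ∀ l, 0 < a l) (hrec : ∀ l, a (l + 1) = h (a l)) :
    ¬ Filter.Tendsto a Filter.atTop (nhds 0) := by
  intro hlim
  have hs := (hasDerivAt_iff_tendsto_slope.mp hd).eventually (lt_mem_nhds hm)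
  have hlim' : Filter.Tendsto a Filter.atTop (nhdsWithin 0 {0}ᶜ) :=
    tendsto_nhdsWithin_iff.mpr ⟨hlim, Filter.Eventually.of_forall fun l => (ha l).ne'⟩
  obtain ⟨N, hN⟩ := Filter.eventually_atTop.mp (hlim'.eventually hs)
  -- The slope of `h` between `0` and `a l` is `a (l + 1) / a l`, eventually above `1`; from then on
  -- the orbit cannot decrease.
  have hstep : ∀ l, N ≤ l → a l ≤ a (l + 1) := fun l hl => by
    have := hN l hl
    rw [slope_def_field, h0, sub_zero, sub_zero, one_lt_div (ha l), ← hrec] at this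
    exact this.le
  have hge : ∀ l, N ≤ l → a N ≤ a l := fun l hl => by
    induction l, hl using Nat.le_induction with
    | base => exact le_rfl
    | succ l hl ih => exact ih.trans (hstep l hl)
  exact (ha N).not_ge (ge_of_tendsto hlim (Filter.eventually_atTop.mpr ⟨N, hge⟩))

theorem C_mul_P_le_one (hvn : ∀ i, 2 ≤ (D.vn i).minDist) (hcn : ∀ i, 2 ≤ (D.cn i).minDist) {q : ℝ}
    (hq : q ∈ Set.Ioc (0 : ℝ) 1)
    (hlim : Filter.Tendsto (D.erasureProb q) Filter.atTop (nhds 0)) : D.C * D.P q ≤ 1 := by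
  by_contra! hlt
  have hd : HasDerivAt (D.cndErasure ∘ D.vndErasure q) (D.C * D.P q) 0 :=
    HasDerivAt.comp 0 (by rw [vndErasure_zero D hvn]; exact D.hasDerivAt_cndErasure hcn)
      (D.hasDerivAt_vndErasure hvn q)
  exact not_tendsto_zero_of_one_lt_deriv hd
    (by rw [Function.comp_apply, vndErasure_zero D hvn, cndErasure_zero D hcn]) hlt
    (fun l => (D.erasureProb_mem hq l).1) (D.erasureProb_succ q) hlim

theorem Pinv_nonneg_and_P_Pinv (hvn : ∀ i, 2 ≤ (D.vn i).minDist)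
    (hP : ∃ i, (D.vn i).minDist = 2 ∧ 0 < D.lam i) {y : ℝ} (hy : 0 ≤ y) :
    0 ≤ D.Pinv y ∧ D.P (D.Pinv y) = y := by
  have hex := (D.bijOn_P hvn hP).surjOn hy
  exact ⟨Function.invFunOn_mem hex, Function.invFunOn_eq hex⟩

theorem threshold_le (hvn : ∀ i, 2 ≤ (D.vn i).minDist) (hcn : ∀ i, 2 ≤ (D.cn i).minDist)
    (hP : ∃ i, (D.vn i).minDist = 2 ∧ 0 < D.lam i)
    (hC : ∃ i, (D.cn i).minDist = 2 ∧ 0 < D.rho i) : D.threshold ≤ D.Pinv (1 / D.C) := by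
  have hCpos := D.C_pos hcn hC
  obtain ⟨h0, hPinv⟩ := D.Pinv_nonneg_and_P_Pinv hvn hP (one_div_pos.mpr hCpos).le
  -- The nonnegativity `h0` covers the empty set, whose real supremum is `0` by convention.
  refine Real.sSup_le (fun q hq => ?_) h0
  obtain ⟨hq01, hlim⟩ := hq
  by_contra! hlt
  have hqpos : 0 < q := h0.trans_lt hlt
  have h1 := D.C_mul_P_le_one hvn hcn ⟨hqpos, hq01.2⟩ hlim
  have h2 := D.strictMonoOn_P hvn hP h0 hqpos.le hlt
  rw [hPinv, div_lt_iff₀' hCpos] at h2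
  exact h2.not_ge h1

/-! ### The LDPC case -/

theorem IsLDPC.P_eq_mul {D : DGLDPCEnsemble} (hD : D.IsLDPC) (hvn : ∀ i, 2 ≤ (D.vn i).minDist)
    (x : ℝ) : D.P x = (Polynomial.derivative D.lamPoly).eval 0 * x := by
  rw [P_eq D hvn, lamPoly, Polynomial.derivative_sum, Polynomial.eval_finsetSum, Finset.sum_mul]
  refine Finset.sum_congr rfl fun i _ => ?_
  have hd := (hD.1 i).minDist_eq
  have h2 := hvn i
  -- Only length-2 repetition codes have weight-2 words, and only their terms in `λ` have nonzero
  -- derivative at `0`.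
  by_cases hn : (D.vn i).n = 2
  · rw [(hD.1 i).weightTwoEnum_eq hn, hn]
    simp
  · rw [ComponentCode.weightTwoEnum, ComponentCode.weightTwoWords_eq_empty _ (by omega)]
    have : (D.vn i).n - 1 - 1 ≠ 0 := by omega
    simp [Polynomial.derivative_X_pow, this]

theorem IsLDPC.C_eq_eval {D : DGLDPCEnsemble} (hD : D.IsLDPC)
    (hcn : ∀ i, 2 ≤ (D.cn i).minDist) :
    D.C = (Polynomial.derivative D.rhoPoly).eval 1 := by
  rw [C, Finset.filter_true_of_mem fun i _ => (hD.2 i).minDist_eq_two (hcn i), rhoPoly,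
    Polynomial.derivative_sum, Polynomial.eval_finsetSum]
  refine Finset.sum_congr rfl fun i _ => ?_
  have hn : 1 ≤ (D.cn i).n := by
    have := (hcn i).trans (D.cn i).minDist_le_length
    omega
  rw [(hD.2 i).two_mul_A2_div (hcn i)]
  simp [Polynomial.derivative_X_pow, Nat.cast_sub hn]

theorem IsLDPC.Pinv_eq {D : DGLDPCEnsemble} (hD : D.IsLDPC) (hvn : ∀ i, 2 ≤ (D.vn i).minDist)
    (hcn : ∀ i, 2 ≤ (D.cn i).minDist) (hP : ∃ i, (D.vn i).minDist = 2 ∧ 0 < D.lam i)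
    (hC : ∃ i, (D.cn i).minDist = 2 ∧ 0 < D.rho i) :
    D.Pinv (1 / D.C) = ((Polynomial.derivative D.lamPoly).eval 0 *
      (Polynomial.derivative D.rhoPoly).eval 1)⁻¹ := by
  have hCpos := D.C_pos hcn hC
  obtain ⟨-, h⟩ := D.Pinv_nonneg_and_P_Pinv hvn hP (one_div_pos.mpr hCpos).le
  rw [hD.P_eq_mul hvn] at h
  rw [← hD.C_eq_eval hcn]
  refine eq_inv_of_mul_eq_one_left ?_
  rw [← mul_assoc, mul_comm (D.Pinv _), h, one_div_mul_cancel hCpos.ne']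

end DGLDPCEnsemble

theorem theorem4 (D : DGLDPCEnsemble)
    (hvn : ∀ i, 2 ≤ (D.vn i).minDist)
    (hcn : ∀ i, 2 ≤ (D.cn i).minDist)
    (hP : ∃ i, (D.vn i).minDist = 2 ∧ 0 < D.lam i)
    (hC : ∃ i, (D.cn i).minDist = 2 ∧ 0 < D.rho i) :
    StrictMonoOn D.P (Set.Ici 0) ∧
    Set.BijOn D.P (Set.Ici 0) (Set.Ici 0) ∧
    0 < D.C ∧
    D.threshold ≤ D.Pinv (1 / D.C) ∧
    (D.IsLDPC →
      D.Pinv (1 / D.C) =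
        ((Polynomial.derivative D.lamPoly).eval 0 * (Polynomial.derivative D.rhoPoly).eval 1)⁻¹ ∧
      D.threshold ≤
        ((Polynomial.derivative D.lamPoly).eval 0 *
          (Polynomial.derivative D.rhoPoly).eval 1)⁻¹) := by
  have hT := D.threshold_le hvn hcn hP hC
  refine ⟨D.strictMonoOn_P hvn hP, D.bijOn_P hvn hP, D.C_pos hcn hC, hT, fun hD => ?_⟩
  have h := hD.Pinv_eq hvn hcn hP hC
  exact ⟨h, h ▸ hT⟩
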